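/- Let $n\ge 1$ and $\omega\in\mathbb{N}$. **The variety.** Let $V$ be the complex vector space with basis $(v_i)_{i\in\mathbb{Z}}$, let $V_\ell=\mathrm{span}(v_\ell,v_{\ell-1},\dots)$, let $\mathrm{pr}_i:V\to V$ be the projection sending $v_i$ to $0$ and fixing the other basis vectors, and let $s_m:V\to V$, $v_i\mapsto v_{i+m}$. Let $\mathrm{SGr}_k$ be the set of subspaces $U\subset V$ such that $V_\ell\subset U$ and $\dim U/V_\ell=k-\ell$ for some $\ell<k$. The finite approximation of the degenerate affine flag variety is $$\mathcal{F}l^a_\omega(\widehat{\mathfrak{gl}}_n)=\Big\{(U_k)_{k=0}^{n-1}\in\prod_{k=0}^{n-1}\mathrm{SGr}_k:\ \mathrm{pr}_{k+1}U_k\subset U_{k+1}\ (0\le k<n-1),\ \mathrm{pr}_nU_{n-1}\subset s_nU_0,\ V_{-\omega n+k}\subseteq U_k\subseteq V_{\omega n+k}\ (0\le k<n)\Big\}.$$ **The cells.** Let $N=\omega n$ and let $e_1,\dots,e_{2N}$ be the standard basis of $\mathbb{C}^{2N}$. Sending $(U_k)$ to the tuple of the preimages $W_k$ of $U_k$ under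 the maps $\mathbb{C}^{2N}\to V$, $e_j\mapsto v_{N+k-j+1}$, identifies $\mathcal{F}l^a_\omega(\widehat{\mathfrak{gl}}_n)$ with the quiver Grassmannian of all tuples $(W_i)_{i\in\mathbb{Z}/n}$ of $N$-dimensional subspaces of $\mathbb{C}^{2N}$ such that $MW_i\subseteq W_{i+1}$ for all $i$, where $Me_j=e_{j+1}$ for $j\ne N,2N$ and $Me_N=Me_{2N}=0$. Let $\lambda\in\mathbb{C}^*$ act, over every vertex $i$, by $\lambda.e_j=\lambda^{2j-1}e_j$ and $\lambda.e_{N+j}=\lambda^{2j}e_{N+j}$ for $1\le j\le N$. The cells of $\mathcal{F}l^a_\omega(\widehat{\mathfrak{gl}}_n)$ are the sets corresponding to the attracting sets $$\mathcal{C}(L)=\{W:\ \lim_{\lambda\to0}\lambda.W=L\}$$ of the points $L$ of the quiver Grassmannian that are fixed by $\mathbb{C}^*$. **The configurations.** Take a rectangle of $2n\times n$ boxes whose left and right sides are identified. In row $j$ (counted from the top, $1\le j\le 2n$) a separator stands at the left side of the box number $m_j+1$, where $m_j\in\{0,\dots,n-1\}$ and $m_j\equiv -j \pmod n$. An affine Dellac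 configuration with parameter $\omega$ is a filling of some of the boxes by numbers in $\{0,1,\dots,\omega\}$ such that 1. every row $j$ contains exactly one number $k_j$; 2. every column contains exactly two numbers; 3. $\sum_{j=1}^{2n}(p_j+nr_j)=\omega n^2$. Here $r_j=\max\{k_j-1,0\}$; if $k_j>0$, then $p_j\in\{1,\dots,n\}$ is the number of steps from the separator of row $j$ to the box containing $k_j$, going left around the cylinder; if $k_j=0$, then the number has to stand in the box immediately to the right of the separator and $p_j=0$. **Theorem.** The set of cells of $\mathcal{F}l^a_\omega(\widehat{\mathfrak{gl}}_n)$ is in bijection with the set of affine Dellac configurations with parameter $\omega$. -/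

import Mathlib

noncomputable section

namespace AffDellac

open Filter Topology

/-! ### The degenerate affine flag variety in Sato Grassmannians -/

/-- The complex vector space `V` with basis `v_i`, `i ∈ ℤ`. -/
abbrev V : Type := ℤ →₀ ℂ

/-- The basis vector `v_i`. -/
def v (i : ℤ) : V := Finsupp.single i 1

/-- The subspace `V_ℓ = span (v_ℓ, v_{ℓ-1}, v_{ℓ-2}, …)`. -/
def Vle (l : ℤ) : Submodule ℂ V := Submodule.span ℂ {x | ∃ i : ℤ, i ≤ l ∧ x = v i}

/-- The dimension of the quotient `U / W` for subspaces `W ⊆ U` (zero if it is infinite). -/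
def relDim {E : Type*} [AddCommGroup E] [Module ℂ E] (W U : Submodule ℂ E) : ℕ :=
  Module.finrank ℂ (U ⧸ W.submoduleOf U)

/-- The Sato Grassmannian `SGr_k`: subspaces `U` with `V_ℓ ⊆ U` and `dim U / V_ℓ = k - ℓ`
for some `ℓ < k` (the dimension is positive, so the quotient is indeed finite dimensional). -/
def SGr (k : ℤ) : Set (Submodule ℂ V) :=
  {U | ∃ l : ℤ, l < k ∧ Vle l ≤ U ∧ (relDim (Vle l) U : ℤ) = k - l}

/-- The projection `pr_i : V → V` sending `v_i` to zero and fixing the other basis vectors. -/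
def pr (i : ℤ) : V →ₗ[ℂ] V := LinearMap.id - (Finsupp.lsingle i) ∘ₗ (Finsupp.lapply i)

/-- The index shift `s_m : V → V`, `v_i ↦ v_{i+m}`. -/
def shift (m : ℤ) : V →ₗ[ℂ] V := Finsupp.lmapDomain ℂ ℂ (fun i : ℤ => i + m)

/-- The degenerate affine flag variety of type `gl_n`, as a set of tuples `(U_0, …, U_{n-1})`. -/
def degFlag (n : ℕ) [NeZero n] : Set (Fin n → Submodule ℂ V) :=
  {U | (∀ k : Fin n, U k ∈ SGr (k : ℕ)) ∧
    (∀ k l : Fin n, (l : ℕ) = (k : ℕ) + 1 → (U k).map (pr ((k : ℕ) + 1)) ≤ U l) ∧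
    (∀ k : Fin n, (k : ℕ) + 1 = n → (U k).map (pr n) ≤ (U 0).map (shift n))}

/-- The finite approximation with parameter `ω`: the tuples of the degenerate affine flag variety
with `V_{-ωn+k} ⊆ U_k ⊆ V_{ωn+k}` for all `k`. -/
def degFlagApprox (n ω : ℕ) [NeZero n] : Set (Fin n → Submodule ℂ V) :=
  {U | U ∈ degFlag n ∧ ∀ k : Fin n,
    Vle (-((ω * n : ℕ) : ℤ) + (k : ℕ)) ≤ U k ∧ U k ≤ Vle (((ω * n : ℕ) : ℤ) + (k : ℕ))}

/-! ### Grassmannians and quiver Grassmannians for the equioriented cycle -/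

/-- The Grassmannian of `e`-dimensional subspaces of `ℂ^m`. -/
def Gr (e m : ℕ) : Type := {W : Submodule ℂ (Fin m → ℂ) // Module.finrank ℂ W = e}

/-- The subspace spanned by an `e`-frame (a linearly independent `e`-tuple) of `ℂ^m`. -/
def frameSpan (e m : ℕ) (f : {f : Fin e → (Fin m → ℂ) // LinearIndependent ℂ f}) : Gr e m :=
  ⟨Submodule.span ℂ (Set.range f.1), by
    rw [finrank_span_eq_card f.2, Fintype.card_fin]⟩

/-- The classical topology of the Grassmannian: the quotient topology from the space of frames. -/
instance (e m : ℕ) : TopologicalSpace (Gr e m) :=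
  TopologicalSpace.coinduced (frameSpan e m) inferInstance

/-- The quiver Grassmannian of the representation `M` of the cycle with vertices `ℤ/n`
(modelled by `Fin n`, whose addition is modulo `n`), arrows `i → i + 1`, vector spaces `ℂ^m`
and maps `M i`: all subrepresentations of dimension vector `e`. -/
def QuiverGr {n m : ℕ} [NeZero n] (M : Fin n → ((Fin m → ℂ) →ₗ[ℂ] (Fin m → ℂ)))
    (e : Fin n → ℕ) : Type :=
  {W : (i : Fin n) → Gr (e i) m // ∀ i : Fin n, (W i).1.map (M i) ≤ (W (i + 1)).1}

/-- The map `s_1 : ℂ^m → ℂ^m`, `e_j ↦ e_{j+1}` for `j < m` and `e_m ↦ 0`. The basis vector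
`e_j`, `1 ≤ j ≤ m`, corresponds to the index `j - 1` in `Fin m`. -/
def finShift (m : ℕ) : (Fin m → ℂ) →ₗ[ℂ] (Fin m → ℂ) where
  toFun x := fun j => if (j : ℕ) = 0 then 0 else x ⟨(j : ℕ) - 1, by omega⟩
  map_add' x y := by
    funext j
    by_cases h : (j : ℕ) = 0 <;> simp [h]
  map_smul' c x := by
    funext j
    by_cases h : (j : ℕ) = 0 <;> simp [h]

/-- The map `pr_i : ℂ^m → ℂ^m` sending `e_i` to zero and fixing the other basis vectors
(with the numbering `e_1, …, e_m`). -/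
def finPr (m i : ℕ) : (Fin m → ℂ) →ₗ[ℂ] (Fin m → ℂ) where
  toFun x := fun j => if (j : ℕ) + 1 = i then 0 else x j
  map_add' x y := by
    funext j
    by_cases h : (j : ℕ) + 1 = i <;> simp [h]
  map_smul' c x := by
    funext j
    by_cases h : (j : ℕ) + 1 = i <;> simp [h]

/-- The maps `s_1 ∘ pr_{ωn}` of the representation `M_ω` on the spaces `ℂ^{2ωn}`. -/
def repM (n ω : ℕ) : Fin n → ((Fin (2 * (ω * n)) → ℂ) →ₗ[ℂ] (Fin (2 * (ω * n)) → ℂ)) :=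
  fun _ => finShift (2 * (ω * n)) ∘ₗ finPr (2 * (ω * n)) (ω * n)

/-- The quiver Grassmannian of `M_ω` for the dimension vector `(ωn, …, ωn)`. -/
abbrev GrM (n ω : ℕ) [NeZero n] : Type := QuiverGr (repM n ω) (fun _ => ω * n)

/-! ### The torus action and its attracting sets -/

/-- The weight of the basis vector `e_j` of `ℂ^{2ωn}` (over every vertex). With respect to the
reordered basis `b_{2k-1} = e_k`, `b_{2k} = e_{ωn+k}`, `1 ≤ k ≤ ωn`, in which the representation
`M_ω` is given by `b_r ↦ b_{r+2}` (so that the segments do not cross), the vector `b_r` has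
weight `r`. Here `j : Fin (2ωn)` stands for `e_{j+1}`. -/
def weight (n ω : ℕ) (j : Fin (2 * (ω * n))) : ℕ :=
  if (j : ℕ) < ω * n then 2 * (j : ℕ) + 1 else 2 * ((j : ℕ) - ω * n) + 2

/-- The diagonal automorphism of `ℂ^m` by which `t ∈ ℂ^*` acts, for given weights `d`. -/
def torusEquiv {m : ℕ} (d : Fin m → ℕ) (t : ℂˣ) : (Fin m → ℂ) ≃ₗ[ℂ] (Fin m → ℂ) :=
  LinearEquiv.piCongrRight fun j => LinearEquiv.smulOfUnit (t ^ d j)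

/-- The action of `t ∈ ℂ^*` on the Grassmannian. -/
def torusAct {e m : ℕ} (d : Fin m → ℕ) (t : ℂˣ) (W : Gr e m) : Gr e m :=
  ⟨W.1.map (torusEquiv d t).toLinearMap, by
    rw [LinearEquiv.finrank_map_eq]; exact W.2⟩

/-- The torus fixed points of the quiver Grassmannian of `M_ω`. -/
def fixedPoints (n ω : ℕ) [NeZero n] : Set (GrM n ω) :=
  {L | ∀ (t : ℂˣ) (i : Fin n), torusAct (weight n ω) t (L.1 i) = L.1 i}

/-- The attracting set of `L`: all points `W` with `lim_{t → 0} t.W = L`. -/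
def attractingSet (n ω : ℕ) [NeZero n] (L : GrM n ω) : Set (GrM n ω) :=
  {W | Tendsto (fun (t : ℂˣ) (i : Fin n) => torusAct (weight n ω) t (W.1 i))
    (comap (fun t : ℂˣ => (t : ℂ)) (𝓝 0)) (𝓝 L.1)}

/-! ### The cells of the approximation -/

/-- The linear map `ℂ^{2ωn} → V`, `e_j ↦ v_{ωn+k-j+1}`, at the vertex `k`. -/
def iota (n ω : ℕ) (k : ℕ) : (Fin (2 * (ω * n)) → ℂ) →ₗ[ℂ] V :=
  Fintype.linearCombination ℂ
    (fun j : Fin (2 * (ω * n)) => v (((ω * n : ℕ) : ℤ) + k - (j : ℕ)))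

/-- The identification of the approximation with the quiver Grassmannian of `M_ω`: the point
`(U_k)` corresponds to the tuple of the subspaces `U_k / V_{-ωn+k}` of
`V_{ωn+k} / V_{-ωn+k} ≅ ℂ^{2ωn}`. -/
def Corresponds (n ω : ℕ) [NeZero n] (U : degFlagApprox n ω) (W : GrM n ω) : Prop :=
  ∀ k : Fin n, (W.1 k).1 = (U.1 k).comap (iota n ω k)

/-- The cell of the approximation that belongs to a point `L` of the quiver Grassmannian: the set
of points corresponding to the points of the attracting set of `L`. -/
def cell (n ω : ℕ) [NeZero n] (L : GrM n ω) : Set (degFlagApprox n ω) :=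
  {U | ∃ W ∈ attractingSet n ω L, Corresponds n ω U W}

/-- The set of cells of the approximation: the attracting sets of the torus fixed points. -/
def cells (n ω : ℕ) [NeZero n] : Set (Set (degFlagApprox n ω)) :=
  {C | ∃ L ∈ fixedPoints n ω, C = cell n ω L}

/-! ### Affine Dellac configurations -/

/-- The number of boxes to the left of the staircase in a row of the planar `2n × n` rectangle.
The rows are numbered `0, …, 2n-1` from top to bottom; the staircase rises from left to right, once
in the rows `0, …, n-1` and once in the rows `n, …, 2n-1`. -/
def leftOfStair (n : ℕ) (j : Fin (2 * n)) : ℕ := n - 1 - (j : ℕ) % n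

/-- The number of steps, in `{1, …, n}`, from the staircase to the box in row `j` and column `c`,
going left around the cylinder. The columns are numbered `0, …, n-1` from left to right. -/
def steps (n : ℕ) (j : Fin (2 * n)) (c : Fin n) : ℕ :=
  if (c : ℕ) < leftOfStair n j then leftOfStair n j - c else leftOfStair n j + n - c

/-- The position `p_j` of an entry `k` in row `j` and column `c`, which is zero for a zero entry. -/
def position (n : ℕ) (j : Fin (2 * n)) (c : Fin n) (k : ℕ) : ℕ :=
  if k = 0 then 0 else steps n j c

/-- An affine Dellac configuration with parameter `ω`: one number `entry j ∈ {0, …, ω}` in every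
row `j`, in the column `col j`, with two numbers in every column. A zero has position zero on the
cylinder, i.e. it stands immediately to the right of the staircase, in the box which is reached
from the staircase after a full turn of `n ≡ 0` steps to the left. -/
@[ext] structure Config (n ω : ℕ) where
  entry : Fin (2 * n) → Fin (ω + 1)
  col : Fin (2 * n) → Fin n
  zero_box : ∀ j, (entry j : ℕ) = 0 → steps n j (col j) = n
  two_per_column : ∀ c : Fin n, (Finset.univ.filter fun j : Fin (2 * n) => col j = c).card = 2
  weighted_sum :
    ∑ j, (position n j (col j) (entry j) + n * max ((entry j : ℕ) - 1) 0) = ω * n ^ 2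

end AffDellac

end

/-! The weights are pairwise distinct, so fixed points are tuples of coordinate subspaces. The orbit
of a fixed point is constant and points of the Grassmannian are closed, so a fixed point lies in its
own attracting set and in no other. Hence cells correspond to fixed points (`cell_injOn`), provided
each fixed point comes from a point of the approximation (`exists_corresponds`).

With N = ωn, the basis of `M_ω` splits into 2n segments of N vectors, one for each component in `Fin
2` and each starting vertex s. A set closed under the maps meets each segment in a terminal piece,
so it amounts to lengths l ≤ N. Since n divides N, a terminal piece of length l lies over s-l, …,
s-1. The dimension over c is thus the number of such passages through c. Going from c-1 to c, it
loses the two pieces whose last vertex is c-1 and gains those with s-l = c. It therefore equals N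
everywhere iff every c is s-l exactly twice and the lengths sum to Nn (`sum_cover_eq_iff`).

This is a configuration: s is the separator of a row, s-l the column of its number, and a positive l
is uniquely p + n(k-1) with 1 ≤ p ≤ n, while l = 0 gives k = 0 (`configEquiv`). -/

noncomputable section

namespace AffDellac

open Filter Topology

/-! ### Coordinate subspaces -/

/-- The subspace of `ℂ^m` spanned by the basis vectors with indices in `S`. -/
def coordSub {m : ℕ} (S : Finset (Fin m)) : Submodule ℂ (Fin m → ℂ) :=
  ⨅ i ∈ ((S : Set (Fin m))ᶜ), LinearMap.ker (LinearMap.proj i : (Fin m → ℂ) →ₗ[ℂ] ℂ)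

lemma mem_coordSub {m : ℕ} {S : Finset (Fin m)} {x : Fin m → ℂ} :
    x ∈ coordSub S ↔ ∀ j ∉ S, x j = 0 := by
  simp [coordSub, Submodule.mem_iInf]

lemma finrank_coordSub {m : ℕ} (S : Finset (Fin m)) :
    Module.finrank ℂ (coordSub S) = S.card := by
  classical
  have e := LinearMap.iInfKerProjEquiv ℂ (fun _ : Fin m => ℂ) (I := (S : Set (Fin m)))
    (J := ((S : Set (Fin m))ᶜ)) disjoint_compl_right (by simp)
  rw [coordSub, e.finrank_eq, Module.finrank_fintype_fun_eq_card]
  simp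

lemma single_mem_coordSub {m : ℕ} {S : Finset (Fin m)} {j : Fin m} :
    Pi.single j (1 : ℂ) ∈ coordSub S ↔ j ∈ S := by
  rw [mem_coordSub]
  constructor
  · intro h
    by_contra hj
    simpa using h j hj
  · intro h i hi
    rw [Pi.single_eq_of_ne]
    rintro rfl
    exact hi h

open Classical in
/-- The indices of the basis vectors contained in a subspace. -/
def basisSet {m : ℕ} (W : Submodule ℂ (Fin m → ℂ)) : Finset (Fin m) :=
  Finset.univ.filter fun j => Pi.single j (1 : ℂ) ∈ W

lemma mem_basisSet {m : ℕ} {W : Submodule ℂ (Fin m → ℂ)} {j : Fin m} :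
    j ∈ basisSet W ↔ Pi.single j (1 : ℂ) ∈ W := by
  simp [basisSet]

lemma basisSet_coordSub {m : ℕ} (S : Finset (Fin m)) : basisSet (coordSub S) = S := by
  ext j
  rw [mem_basisSet, single_mem_coordSub]

lemma torusEquiv_apply {m : ℕ} (d : Fin m → ℕ) (t : ℂˣ) (x : Fin m → ℂ) (j : Fin m) :
    torusEquiv d t x j = (t : ℂ) ^ d j * x j := by
  simp [torusEquiv, LinearEquiv.smulOfUnit, Units.smul_def]

/-- A subspace stable under a diagonal operator with distinct eigenvalues is a coordinate
subspace. -/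
lemma coordSub_basisSet_of_stable {m : ℕ} (a : Fin m → ℂ) (ha : Function.Injective a)
    (W : Submodule ℂ (Fin m → ℂ)) (hW : ∀ x ∈ W, (fun j => a j * x j) ∈ W) :
    coordSub (basisSet W) = W := by
  classical
  -- Products of the operators `D - a k`, with `D` the diagonal operator, preserve `W`. Taking all
  -- `k ≠ j` kills every coordinate except the one at `j`.
  have key : ∀ x ∈ W, ∀ s : Finset (Fin m),
      (fun i => (∏ k ∈ s, (a i - a k)) * x i) ∈ W := by
    intro x hx s
    induction s using Finset.induction_on with
    | empty => simpa using hx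
    | insert k s hk ih =>
      have h := W.sub_mem (hW _ ih) (W.smul_mem (a k) ih)
      convert h using 1
      funext i
      simp [Finset.prod_insert hk]
      ring
  apply le_antisymm
  · intro x hx
    rw [mem_coordSub] at hx
    rw [pi_eq_sum_univ' x]
    refine W.sum_mem fun j _ => ?_
    by_cases hj : j ∈ basisSet W
    · have := W.smul_mem (x j) (mem_basisSet.1 hj)
      convert this using 2
    · rw [hx j hj, zero_smul]
      exact W.zero_mem
  · intro x hx
    rw [mem_coordSub]
    intro j hj
    by_contra hxj
    apply hj
    rw [mem_basisSet]
    have h := key x hx (Finset.univ.erase j)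
    have hp : (∏ k ∈ Finset.univ.erase j, (a j - a k)) * x j ≠ 0 := by
      refine mul_ne_zero (Finset.prod_ne_zero_iff.2 fun k hk => ?_) hxj
      rw [sub_ne_zero]
      exact fun h => (Finset.ne_of_mem_erase hk) (ha h).symm
    have h2 := W.smul_mem ((∏ k ∈ Finset.univ.erase j, (a j - a k)) * x j)⁻¹ h
    convert h2 using 1
    funext i
    by_cases hij : i = j
    · subst hij
      simp only [Pi.single_eq_same, Pi.smul_apply, smul_eq_mul]
      exact (inv_mul_cancel₀ hp).symm
    · have : ∏ k ∈ Finset.univ.erase j, (a i - a k) = 0 :=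
        Finset.prod_eq_zero (Finset.mem_erase.2 ⟨hij, Finset.mem_univ i⟩) (sub_self _)
      simp [Pi.single_eq_of_ne hij, this]

lemma weight_injective (n ω : ℕ) : Function.Injective (weight n ω) := by
  intro i j h
  unfold weight at h
  ext
  split_ifs at h <;> omega

lemma torusAct_eq_self_iff {e m : ℕ} (d : Fin m → ℕ) (hd : Function.Injective d) (W : Gr e m) :
    (∀ t : ℂˣ, torusAct d t W = W) ↔ coordSub (basisSet W.1) = W.1 := by
  constructor
  · intro h
    -- The single element t = 2 suffices: its powers with distinct exponents are distinct
    -- eigenvalues.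
    have h2 : (2 : ℂ) ≠ 0 := two_ne_zero
    refine coordSub_basisSet_of_stable (fun j => (2 : ℂ) ^ d j) ?_ W.1 ?_
    · intro i j hij
      apply hd
      have : ((2 ^ d i : ℕ) : ℂ) = ((2 ^ d j : ℕ) : ℂ) := by push_cast; exact hij
      exact Nat.pow_right_injective le_rfl (Nat.cast_injective this)
    · intro x hx
      have ht := congrArg Subtype.val (h (Units.mk0 2 h2))
      rw [← ht]
      refine ⟨x, hx, ?_⟩
      funext j
      simp [torusEquiv_apply]
  · intro h t
    apply Subtype.ext
    refine Submodule.eq_of_le_of_finrank_eq ?_ ?_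
    · rintro _ ⟨x, hx, rfl⟩
      have hx : x ∈ W.1 := hx
      rw [← h, mem_coordSub] at hx ⊢
      intro j hj
      change torusEquiv d t x j = 0
      rw [torusEquiv_apply, hx j hj, mul_zero]
    · rw [(torusAct d t W).2, W.2]

/-! ### Fixed points as successor-closed tuples of coordinate sets -/

/-- Tuples of `N`-element index sets over the vertices of the cycle that are closed under the
maps of the representation `M_ω`. -/
def ClosedTuple (n N : ℕ) [NeZero n] : Type :=
  {S : Fin n → Finset (Fin (2 * N)) // (∀ i, (S i).card = N) ∧
    ∀ i, ∀ j j' : Fin (2 * N), (j' : ℕ) = j + 1 → (j' : ℕ) ≠ N → j ∈ S i → j' ∈ S (i + 1)}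

lemma repM_apply (n ω : ℕ) (i : Fin n) (x : Fin (2 * (ω * n)) → ℂ) (j : Fin (2 * (ω * n))) :
    repM n ω i x j = if (j : ℕ) = 0 then 0 else
      if (j : ℕ) - 1 + 1 = ω * n then 0 else x ⟨(j : ℕ) - 1, by omega⟩ := rfl

/-- Indices start at zero, so `j' = ω * n` stands for e_{ωn+1}, whose predecessor e_{ωn} is killed.
-/
lemma map_repM_coordSub_le_iff (n ω : ℕ) (i : Fin n) (S S' : Finset (Fin (2 * (ω * n)))) :
    (coordSub S).map (repM n ω i) ≤ coordSub S' ↔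
      ∀ j j' : Fin (2 * (ω * n)), (j' : ℕ) = j + 1 → (j' : ℕ) ≠ ω * n → j ∈ S → j' ∈ S' := by
  constructor
  · intro h j j' hj hN hS
    by_contra hS'
    have h1 := mem_coordSub.1 (h ⟨_, single_mem_coordSub.2 hS, rfl⟩) j' hS'
    rw [repM_apply, if_neg (by omega), if_neg (by omega)] at h1
    have : (⟨(j' : ℕ) - 1, by omega⟩ : Fin (2 * (ω * n))) = j := by ext; simp; omega
    rw [this] at h1
    simp at h1
  · rintro h _ ⟨x, hx, rfl⟩
    rw [mem_coordSub]
    intro j' hj'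
    rw [repM_apply]
    split_ifs with h0 hN
    · rfl
    · rfl
    · refine mem_coordSub.1 hx _ fun hS => hj' (h _ j' ?_ ?_ hS)
      · simp; omega
      · omega

lemma coordSub_basisSet_of_mem_fixedPoints {n ω : ℕ} [NeZero n] {L : GrM n ω}
    (hL : L ∈ fixedPoints n ω) (i : Fin n) : coordSub (basisSet (L.1 i).1) = (L.1 i).1 :=
  (torusAct_eq_self_iff _ (weight_injective n ω) _).1 fun t => hL t i

/-- The torus fixed points are the tuples of coordinate subspaces. -/
def fixedPointsEquiv (n ω : ℕ) [NeZero n] : fixedPoints n ω ≃ ClosedTuple n (ω * n) where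
  toFun L := ⟨fun i => basisSet (L.1.1 i).1, fun i => by
      rw [← finrank_coordSub, coordSub_basisSet_of_mem_fixedPoints L.2]
      exact (L.1.1 i).2, fun i => by
      rw [← map_repM_coordSub_le_iff, coordSub_basisSet_of_mem_fixedPoints L.2,
        coordSub_basisSet_of_mem_fixedPoints L.2]
      exact L.1.2 i⟩
  invFun S := ⟨⟨fun i => ⟨coordSub (S.1 i), by rw [finrank_coordSub, S.2.1]⟩, fun i =>
      (map_repM_coordSub_le_iff n ω i _ _).2 (S.2.2 i)⟩, fun t i =>
      (torusAct_eq_self_iff _ (weight_injective n ω) _).2 (by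
        change coordSub (basisSet (coordSub (S.1 i))) = coordSub (S.1 i)
        rw [basisSet_coordSub]) t⟩
  left_inv L := by
    apply Subtype.ext
    apply Subtype.ext
    funext i
    exact Subtype.ext (coordSub_basisSet_of_mem_fixedPoints L.2 i)
  right_inv S := by
    apply Subtype.ext
    funext i
    exact basisSet_coordSub _

/-! ### The points of the approximation given by coordinate subspaces -/

lemma Vle_eq_supported (l : ℤ) : Vle l = Finsupp.supported ℂ ℂ (Set.Iic l) := by
  rw [Finsupp.supported_eq_span_single, Vle]
  congr 1
  ext x
  simp [v, eq_comm]

lemma pr_apply (i : ℤ) (x : V) (a : ℤ) : pr i x a = if a = i then 0 else x a := by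
  by_cases h : a = i
  · subst h; simp [pr]
  · simp [pr, h]

/-- Restriction to the coordinates in `F` is surjective with kernel the vectors supported on `B`. -/
lemma relDim_supported {B A : Set ℤ} (F : Finset ℤ) (hA : A = B ∪ F) (hd : ∀ i ∈ F, i ∉ B) :
    relDim (Finsupp.supported ℂ ℂ B) (Finsupp.supported ℂ ℂ A : Submodule ℂ V) = F.card := by
  let f : (Finsupp.supported ℂ ℂ A : Submodule ℂ V) →ₗ[ℂ] (F → ℂ) :=
    (LinearMap.pi fun i : F => Finsupp.lapply (i : ℤ)) ∘ₗ Submodule.subtype _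
  have hf : ∀ x i, f x i = (x : V) (i : ℤ) := fun x i => rfl
  have hker : LinearMap.ker f = (Finsupp.supported ℂ ℂ B).submoduleOf
      (Finsupp.supported ℂ ℂ A) := by
    ext x
    have hx := (Finsupp.mem_supported' ℂ (x : V)).1 x.2
    rw [LinearMap.mem_ker, Submodule.submoduleOf, Submodule.mem_comap, Submodule.subtype_apply,
      Finsupp.mem_supported']
    constructor
    · intro h i hi
      by_cases hF : i ∈ F
      · simpa [hf] using congrFun h ⟨i, hF⟩
      · exact hx i (by simp [hA, hi, hF])
    · intro h
      funext i
      exact h i (hd i i.2)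
  have hsurj : Function.Surjective f := by
    classical
    intro y
    refine ⟨⟨∑ i : F, Finsupp.single (i : ℤ) (y i), Submodule.sum_mem _ fun i _ =>
      Finsupp.single_mem_supported ℂ _ (by simp [hA])⟩, ?_⟩
    funext j
    rw [hf]
    simp [Finsupp.finsetSum_apply, Finsupp.single_apply]
  rw [relDim, ← hker, (f.quotKerEquivOfSurjective hsurj).finrank_eq,
    Module.finrank_fintype_fun_eq_card, Fintype.card_coe]

/-- The indices of the basis vectors that span the point of the Sato Grassmannian corresponding to
a coordinate subspace at the vertex `k`. -/
def liftSet (N : ℕ) (k : ℤ) (S : Finset (Fin (2 * N))) : Set ℤ :=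
  {i | i ≤ k - N ∨ ∃ j ∈ S, i = N + k - (j : ℕ)}

lemma supported_liftSet_mem_SGr {N : ℕ} (k : ℤ) (S : Finset (Fin (2 * N))) (hS : S.card = N) :
    (Finsupp.supported ℂ ℂ (liftSet N k S) : Submodule ℂ V) ∈ SGr k := by
  classical
  -- One below the natural bound `k - N`, since `l < k` must be strict even for `N = 0`; the extra
  -- vector `v (k - N)` is counted with those from `S`.
  refine ⟨k - N - 1, by omega, ?_, ?_⟩
  · rw [Vle_eq_supported]
    refine Finsupp.supported_mono fun i hi => Or.inl ?_
    simp at hi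
    omega
  · rw [Vle_eq_supported, relDim_supported
      (insert (k - N) (S.image fun j : Fin (2 * N) => (N : ℤ) + k - (j : ℕ)))]
    · rw [Finset.card_insert_of_notMem, Finset.card_image_of_injective, hS]
      · push_cast; ring
      · intro i j h
        ext
        simp at h
        exact h
      · simp only [Finset.mem_image, not_exists, not_and]
        intro j _
        omega
    · ext i
      simp only [liftSet, Set.mem_ofPred_eq, Finset.coe_insert, Finset.coe_image, Set.mem_union,
        Set.mem_Iic, Set.mem_insert_iff, Set.mem_image, Finset.mem_coe]
      constructor
      · rintro (h | ⟨j, hj, rfl⟩)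
        · rcases h.lt_or_eq with h | h
          · left; omega
          · right; left; exact h
        · right; right; exact ⟨j, hj, rfl⟩
      · rintro (h | rfl | ⟨j, hj, rfl⟩)
        · left; omega
        · left; exact le_rfl
        · right; exact ⟨j, hj, rfl⟩
    · intro i hi
      simp only [Finset.mem_insert, Finset.mem_image] at hi
      simp only [Set.mem_Iic]
      rcases hi with rfl | ⟨j, hj, rfl⟩ <;> omega

lemma map_pr_supported_le {A B : Set ℤ} (i : ℤ) (h : ∀ a ∈ A, a ≠ i → a ∈ B) :
    (Finsupp.supported ℂ ℂ A : Submodule ℂ V).map (pr i) ≤ Finsupp.supported ℂ ℂ B := by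
  rintro _ ⟨x, hx, rfl⟩
  rw [Finsupp.mem_supported']
  intro a ha
  rw [pr_apply]
  split_ifs with hai
  · rfl
  · exact (Finsupp.mem_supported' ℂ x).1 hx a fun hA => ha (h a hA hai)

lemma map_shift_supported (A : Set ℤ) (m : ℤ) :
    (Finsupp.supported ℂ ℂ A : Submodule ℂ V).map (shift m) =
      Finsupp.supported ℂ ℂ ((fun i : ℤ => i + m) '' A) :=
  Finsupp.lmapDomain_supported ℂ ℂ (fun i : ℤ => i + m) A

/-- The shift e_j ↦ e_{j+1} is the identity on V once k becomes k+1. The excluded index k+1 is the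
broken arrow at N, and the last basis vector falls into the tail at k+1. -/
lemma liftSet_succ {N : ℕ} (k : ℤ) {S S' : Finset (Fin (2 * N))}
    (h : ∀ j j' : Fin (2 * N), (j' : ℕ) = j + 1 → (j' : ℕ) ≠ N → j ∈ S → j' ∈ S') :
    ∀ a ∈ liftSet N k S, a ≠ k + 1 → a ∈ liftSet N (k + 1) S' := by
  rintro a (ha | ⟨j, hj, rfl⟩) hne
  · left; omega
  · by_cases hj2 : (j : ℕ) + 1 < 2 * N
    · right
      refine ⟨⟨j + 1, hj2⟩, h j _ rfl ?_ hj, ?_⟩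
      · simp; omega
      · push_cast; ring
    · left; omega

/-- This reads s_n U_0 as the point at index n, so that the closing arrow of the cycle is handled by
`liftSet_succ` like the others. -/
lemma image_add_liftSet {N : ℕ} (k m : ℤ) (S : Finset (Fin (2 * N))) :
    (fun i : ℤ => i + m) '' liftSet N k S = liftSet N (k + m) S := by
  ext i
  constructor
  · rintro ⟨a, ha | ⟨j, hj, rfl⟩, rfl⟩
    · left; dsimp only; omega
    · right; exact ⟨j, hj, by ring⟩
  · rintro (ha | ⟨j, hj, rfl⟩)
    · exact ⟨i - m, Or.inl (by omega), by ring⟩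
    · exact ⟨N + k - (j : ℕ), Or.inr ⟨j, hj, rfl⟩, by ring⟩

/-- The point of the approximation corresponding to a tuple of coordinate subspaces. -/
def liftPoint (n ω : ℕ) [NeZero n] (S : ClosedTuple n (ω * n)) (k : Fin n) : Submodule ℂ V :=
  Finsupp.supported ℂ ℂ (liftSet (ω * n) (k : ℕ) (S.1 k))

lemma liftPoint_mem (n ω : ℕ) [NeZero n] (S : ClosedTuple n (ω * n)) :
    liftPoint n ω S ∈ degFlagApprox n ω := by
  refine ⟨⟨fun k => supported_liftSet_mem_SGr _ _ (S.2.1 k), ?_, ?_⟩, fun k => ⟨?_, ?_⟩⟩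
  · intro k l hkl
    have hl : k + 1 = l := by
      apply Fin.ext
      rw [hkl, Fin.val_add_one_of_lt']
      omega
    refine map_pr_supported_le _ ?_
    have := liftSet_succ (k : ℕ) (S.2.2 k)
    rw [hl] at this
    rw [hkl]
    push_cast
    exact this
  · intro k hk
    have h0 : k + 1 = 0 := by
      apply Fin.ext
      rw [Fin.val_add, Fin.val_zero]
      have : ((1 : Fin n) : ℕ) = 1 % n := Fin.val_one' n
      rw [this, Nat.add_mod_mod, hk, Nat.mod_self]
    rw [liftPoint, liftPoint, map_shift_supported, image_add_liftSet]
    refine map_pr_supported_le _ ?_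
    have := liftSet_succ (k : ℕ) (S.2.2 k)
    rw [h0] at this
    have hk' : ((k : ℕ) : ℤ) + 1 = n := by exact_mod_cast hk
    rw [hk'] at this
    simpa using this
  · rw [Vle_eq_supported]
    refine Finsupp.supported_mono fun i hi => Or.inl ?_
    rw [Set.mem_Iic] at hi
    omega
  · rw [Vle_eq_supported]
    refine Finsupp.supported_mono ?_
    have hN : (0 : ℤ) ≤ ((ω * n : ℕ) : ℤ) := Int.natCast_nonneg _
    rintro i (hi | ⟨j, -, rfl⟩) <;> rw [Set.mem_Iic] <;> omega

lemma iota_apply (n ω k : ℕ) (x : Fin (2 * (ω * n)) → ℂ) (j : Fin (2 * (ω * n))) :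
    iota n ω k x (((ω * n : ℕ) : ℤ) + k - (j : ℕ)) = x j := by
  rw [iota, Fintype.linearCombination_apply, Finsupp.finsetSum_apply, Finset.sum_eq_single j]
  · simp [v]
  · intro i _ hij
    have : ((i : ℕ) : ℤ) ≠ (j : ℕ) := fun h => hij (Fin.ext (by exact_mod_cast h))
    simp [v, this]
  · simp

lemma iota_mem_supported_iff (n ω k : ℕ) (S : Finset (Fin (2 * (ω * n))))
    (x : Fin (2 * (ω * n)) → ℂ) :
    iota n ω k x ∈ (Finsupp.supported ℂ ℂ (liftSet (ω * n) k S) : Submodule ℂ V) ↔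
      x ∈ coordSub S := by
  constructor
  · intro h
    rw [mem_coordSub]
    intro j hj
    rw [← iota_apply n ω k x j]
    refine (Finsupp.mem_supported' ℂ _).1 h _ ?_
    rintro (h | ⟨i, hi, h⟩)
    · omega
    · have : i = j := Fin.ext (by omega)
      exact hj (this ▸ hi)
  · intro h
    rw [iota, Fintype.linearCombination_apply]
    refine Submodule.sum_mem _ fun j _ => ?_
    by_cases hj : j ∈ S
    · exact Submodule.smul_mem _ _ (Finsupp.single_mem_supported ℂ _ (Or.inr ⟨j, hj, rfl⟩))
    · rw [mem_coordSub.1 h j hj, zero_smul]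
      exact Submodule.zero_mem _

/-- Cells are subsets of the approximation; this keeps the cell of a fixed point nonempty. The full
identification with the quiver Grassmannian is not needed. -/
lemma exists_corresponds {n ω : ℕ} [NeZero n] {L : GrM n ω} (hL : L ∈ fixedPoints n ω) :
    ∃ U, Corresponds n ω U L := by
  refine ⟨⟨_, liftPoint_mem n ω (fixedPointsEquiv n ω ⟨L, hL⟩)⟩, fun k => ?_⟩
  ext x
  rw [Submodule.mem_comap]
  refine Iff.trans ?_ (iota_mem_supported_iff n ω k _ x).symm
  exact (coordSub_basisSet_of_mem_fixedPoints hL k).symm ▸ Iff.rfl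

/-! ### Cells and fixed points -/

/-- A frame spans `L` iff its vectors lie in `L`, a closed condition. Closed points suffice below
because only constant orbits are compared. -/
instance (e m : ℕ) : T1Space (Gr e m) := by
  refine ⟨fun L => ?_⟩
  refine isClosed_coinduced.2 ?_
  have : frameSpan e m ⁻¹' {L} = ⋂ i, {f | f.1 i ∈ L.1} := by
    ext f
    simp only [Set.mem_preimage, Set.mem_singleton_iff, Set.mem_iInter, Set.mem_ofPred_eq]
    constructor
    · rintro rfl i
      exact Submodule.subset_span ⟨i, rfl⟩
    · intro h
      refine Subtype.ext (Submodule.eq_of_le_of_finrank_eq ?_ ?_)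
      · refine Submodule.span_le.2 ?_
        rintro _ ⟨i, rfl⟩
        exact h i
      · rw [(frameSpan e m f).2, L.2]
  rw [this]
  refine isClosed_iInter fun i => ?_
  exact (Submodule.closed_of_finiteDimensional L.1).preimage
    ((continuous_apply i).comp continuous_subtype_val)

/-- Zero is a limit of nonzero complex numbers; otherwise every limit statement would be vacuous. -/
instance : (comap (fun t : ℂˣ => (t : ℂ)) (𝓝 0)).NeBot := by
  rw [comap_neBot_iff]
  intro s hs
  have h : (s ∩ {0}ᶜ) ∈ 𝓝[≠] (0 : ℂ) := inter_mem (mem_nhdsWithin_of_mem_nhds hs)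
    self_mem_nhdsWithin
  obtain ⟨z, hz, hz0⟩ := (inferInstance : (𝓝[≠] (0 : ℂ)).NeBot).nonempty_of_mem h
  exact ⟨Units.mk0 z hz0, hz⟩

lemma mem_attractingSet_iff {n ω : ℕ} [NeZero n] {L L' : GrM n ω} (hL : L ∈ fixedPoints n ω) :
    L ∈ attractingSet n ω L' ↔ L = L' := by
  have h : (fun (t : ℂˣ) (i : Fin n) => torusAct (weight n ω) t (L.1 i)) = fun _ => L.1 := by
    funext t i
    exact hL t i
  rw [attractingSet, Set.mem_ofPred_eq, h, tendsto_const_nhds_iff]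
  exact Subtype.ext_iff.symm

lemma Corresponds.unique {n ω : ℕ} [NeZero n] {U : degFlagApprox n ω} {W W' : GrM n ω}
    (h : Corresponds n ω U W) (h' : Corresponds n ω U W') : W = W' := by
  apply Subtype.ext
  funext k
  exact Subtype.ext ((h k).trans (h' k).symm)

/-- The point of the approximation given by `L` lies in the cell of `L`. If it also lies in that of
`L'`, then `L` is attracted to `L'`, which forces equality. -/
lemma cell_injOn (n ω : ℕ) [NeZero n] : Set.InjOn (cell n ω) (fixedPoints n ω) := by
  intro L hL L' _ h
  obtain ⟨U, hU⟩ := exists_corresponds hL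
  have hc : U ∈ cell n ω L := ⟨L, (mem_attractingSet_iff hL).2 rfl, hU⟩
  rw [h] at hc
  obtain ⟨W, hW, hUW⟩ := hc
  rw [← hU.unique hUW] at hW
  exact (mem_attractingSet_iff hL).1 hW

/-- Every cell contains exactly one torus fixed point. -/
def cellsEquiv (n ω : ℕ) [NeZero n] : fixedPoints n ω ≃ cells n ω :=
  ((cell_injOn n ω).bijOn_image.equiv _).trans (Equiv.setCongr (by
    ext C
    simp [cells, eq_comm]))

end AffDellac

end
noncomputable section

namespace AffDellac

open scoped Fin.CommRing

/-! ### Segment lengths -/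

/-- Lengths of segments with prescribed starting points on the cycle such that every point of the
cycle is the end of exactly two of them. -/
def Lengths {ι : Type} [Fintype ι] {n : ℕ} [NeZero n] (s : ι → Fin n) (N : ℕ) : Type :=
  {l : ι → ℕ // (∀ i, l i ≤ N) ∧
    (∀ c, (Finset.univ.filter fun i => s i - (l i : Fin n) = c).card = 2) ∧ ∑ i, l i = N * n}

/-- Reindexing of segments. -/
def Lengths.reindex {ι κ : Type} [Fintype ι] [Fintype κ] {n : ℕ} [NeZero n] {s : ι → Fin n}
    {r : κ → Fin n} (e : ι ≃ κ) (h : ∀ i, r (e i) = s i) (N : ℕ) : Lengths s N ≃ Lengths r N :=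
  (e.arrowCongr (Equiv.refl ℕ)).subtypeEquiv fun l => by
    refine and_congr ?_ (and_congr (forall_congr' fun c => ?_) ?_)
    · rw [← e.forall_congr_right]
      simp
    · rw [Finset.card_equiv e]
      intro i
      simp [h]
    · rw [← e.sum_comp]
      simp

/-- The number of segments of lengths `l` that pass through the point `c` of the cycle. -/
def cover {n : ℕ} [NeZero n] (N : ℕ) (l : Fin n → ℕ) (c : Fin n) : ℕ :=
  ∑ u ∈ Finset.range N, if u < l (c + 1 + (u : Fin n)) then 1 else 0

/-- Exactly one starting point is s = c, whose passages begin at c-1. Formally, sum [u ≤ l] = [u <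
l] + [u = l] over u ≤ N with l taken at c+u; the term u = 0 on the left is the summand 1. -/
lemma cover_add_one {n : ℕ} [NeZero n] (N : ℕ) (l : Fin n → ℕ) (hl : ∀ s, l s ≤ N) (c : Fin n) :
    cover N l c + 1 =
      cover N l (c - 1) + (Finset.univ.filter fun s => s - (l s : Fin n) = c).card := by
  have h1 : cover N l c + 1 =
      ∑ u ∈ Finset.range (N + 1), if u ≤ l (c + (u : Fin n)) then 1 else 0 := by
    rw [Finset.sum_range_succ', cover]
    simp only [Nat.cast_zero, Nat.zero_le, if_true, Nat.succ_le_iff, Nat.cast_add, Nat.cast_one,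
      add_assoc, add_comm (1 : Fin n)]
  have h2 : cover N l (c - 1) =
      ∑ u ∈ Finset.range (N + 1), if u < l (c + (u : Fin n)) then 1 else 0 := by
    rw [Finset.sum_range_succ, if_neg (hl _).not_gt, cover]
    simp
  have h3 : (Finset.univ.filter fun s => s - (l s : Fin n) = c).card =
      ∑ u ∈ Finset.range (N + 1), if u = l (c + (u : Fin n)) then 1 else 0 := by
    have h : ∀ s, (if s - (l s : Fin n) = c then 1 else 0) =
        ∑ u ∈ Finset.range (N + 1), if s = c + (u : Fin n) then (if u = l s then 1 else 0) else 0 := by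
      intro s
      rw [Finset.sum_eq_single (l s)]
      · simp [sub_eq_iff_eq_add]
      · intro u _ hu
        simp [hu]
      · intro hs
        exact absurd (Finset.mem_range.2 (Nat.lt_succ_of_le (hl s))) hs
    rw [Finset.card_filter, Finset.sum_congr rfl fun s _ => h s, Finset.sum_comm]
    refine Finset.sum_congr rfl fun u _ => ?_
    rw [Finset.sum_ite_eq' Finset.univ]
    simp
  rw [h1, h2, h3, ← Finset.sum_add_distrib]
  refine Finset.sum_congr rfl fun u _ => ?_
  split_ifs <;> omega

lemma sum_cover {n : ℕ} [NeZero n] (N : ℕ) (l : Fin n → ℕ) (hl : ∀ s, l s ≤ N) :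
    ∑ c, cover N l c = ∑ s, l s := by
  unfold cover
  rw [Finset.sum_comm]
  have h : ∀ u : ℕ, ∑ c : Fin n, (if u < l (c + 1 + (u : Fin n)) then 1 else 0) =
      ∑ c : Fin n, if u < l c then 1 else 0 := by
    intro u
    refine Fintype.sum_equiv (Equiv.addRight (1 + (u : Fin n))) _ _ fun c => ?_
    simp [add_assoc]
  rw [Finset.sum_congr rfl fun u _ => h u, Finset.sum_comm]
  refine Finset.sum_congr rfl fun s _ => ?_
  rw [← Finset.card_filter]
  have : (Finset.range N).filter (fun u => u < l s) = Finset.range (l s) := by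
    ext u
    have := hl s
    simp only [Finset.mem_filter, Finset.mem_range]
    omega
  rw [this, Finset.card_range]

lemma eq_zero_of_sub_one {n : ℕ} [NeZero n] {f : Fin n → ℕ} (h : ∀ c, f c = f (c - 1))
    (c : Fin n) : f c = f 0 := by
  have : ∀ k : ℕ, f (k : Fin n) = f 0 := by
    intro k
    induction k with
    | zero => simp
    | succ k ih => rw [h, ← ih]; simp
  simpa using this (c : ℕ)

/-- By `cover_add_one` for both components, the total cover is constant on the cycle iff every c is
hit twice; the sum of the lengths then fixes the constant. -/
lemma sum_cover_eq_iff {n : ℕ} [NeZero n] (N : ℕ) (l : Fin 2 × Fin n → ℕ) (hl : ∀ i, l i ≤ N) :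
    (∀ c, ∑ a, cover N (fun s => l (a, s)) c = N) ↔
      (∀ c, (Finset.univ.filter fun i : Fin 2 × Fin n => i.2 - (l i : Fin n) = c).card = 2) ∧
        ∑ i, l i = N * n := by
  have h1 : ∀ c, ∑ a, cover N (fun s => l (a, s)) c + 2 =
      ∑ a, cover N (fun s => l (a, s)) (c - 1) +
        (Finset.univ.filter fun i : Fin 2 × Fin n => i.2 - (l i : Fin n) = c).card := by
    intro c
    have h := fun a => cover_add_one N (fun s => l (a, s)) (fun s => hl _) c
    simp only [Finset.card_filter] at h ⊢
    rw [Fintype.sum_prod_type]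
    simp only [Fin.sum_univ_two] at h ⊢
    have h0 := h 0
    have h1 := h 1
    omega
  have h2 : ∑ c, ∑ a, cover N (fun s => l (a, s)) c = ∑ i, l i := by
    rw [Finset.sum_comm, Fintype.sum_prod_type]
    exact Finset.sum_congr rfl fun a _ => sum_cover N _ fun s => hl _
  constructor
  · intro h
    constructor
    · intro c
      have := h1 c
      rw [h, h] at this
      omega
    · rw [← h2, Finset.sum_congr rfl fun c _ => h c]
      simp [mul_comm]
  · rintro ⟨h, hs⟩
    have hc : ∀ c, ∑ a, cover N (fun s => l (a, s)) c = ∑ a, cover N (fun s => l (a, s)) 0 :=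
      eq_zero_of_sub_one (f := fun c => ∑ a, cover N (fun s => l (a, s)) c) fun c => by
        have := h1 c
        rw [h] at this
        omega
    rw [Finset.sum_congr rfl fun c _ => hc c, hs, Finset.sum_const, Finset.card_univ,
      Fintype.card_fin, smul_eq_mul, mul_comm] at h2
    intro c
    rw [hc]
    exact Nat.eq_of_mul_eq_mul_right (Nat.pos_of_neZero n) h2

/-! ### Closed tuples and segment lengths -/

/-- An upward closed subset of a chain is a final interval, so its cardinality decides membership.
-/
lemma mem_iff_le_add_card {N : ℕ} (P : Fin N → Prop) [DecidablePred P]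
    (hP : ∀ t t' : Fin N, (t' : ℕ) = t + 1 → P t → P t') (t : Fin N) :
    P t ↔ N ≤ t + (Finset.univ.filter P).card := by
  have mono : ∀ k : ℕ, ∀ t t' : Fin N, (t' : ℕ) = t + k → P t → P t' := by
    intro k
    induction k with
    | zero => intro t t' h; rw [show t' = t from Fin.ext h]; exact id
    | succ k ih =>
      intro t t' h ht
      exact hP ⟨t + k, by omega⟩ t' h (ih t _ rfl ht)
  constructor
  · intro ht
    have : Finset.Ici t ⊆ Finset.univ.filter P := by
      intro u hu
      have hu : t ≤ u := Finset.mem_Ici.1 hu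
      have hu : (t : ℕ) ≤ u := hu
      exact Finset.mem_filter.2 ⟨Finset.mem_univ u, mono (u - t) t u (by omega) ht⟩
    have := Finset.card_le_card this
    rw [Fin.card_Ici] at this
    omega
  · intro h
    by_contra ht
    have : Finset.univ.filter P ⊆ Finset.Ioi t := by
      intro u hu
      rw [Finset.mem_Ioi]
      by_contra hut
      have hut : (u : ℕ) ≤ t := not_lt.1 hut
      exact ht (mono (t - u) u t (by omega) (Finset.mem_filter.1 hu).2)
    have := Finset.card_le_card this
    rw [Fin.card_Ioi] at this
    omega

lemma card_filter_le_add {N l : ℕ} (hl : l ≤ N) :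
    (Finset.univ.filter fun t : Fin N => N ≤ t + l).card = l := by
  rw [Finset.card_filter, Fin.sum_univ_eq_sum_range (fun t => if N ≤ t + l then 1 else 0),
    ← Finset.card_filter]
  have : (Finset.range N).filter (fun t => N ≤ t + l) = Finset.Ico (N - l) N := by
    ext t
    simp only [Finset.mem_filter, Finset.mem_range, Finset.mem_Ico]
    omega
  rw [this, Nat.card_Ico]
  omega

/-- The tuple of index sets formed by the ends of given lengths of the segments of `M_ω`. -/
def tupleOfLengths {n : ℕ} [NeZero n] (N : ℕ) (l : Fin 2 × Fin n → ℕ) (c : Fin n) :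
    Finset (Fin (2 * N)) :=
  (Finset.univ.filter fun x : Fin 2 × Fin N =>
    N ≤ (x.2 : ℕ) + l (x.1, c - ((x.2 : ℕ) : Fin n))).map finProdFinEquiv.toEmbedding

/-- The number of elements that a tuple of index sets has in common with the segment in the
component `i.1` that starts at the vertex `i.2`. -/
def lengthsOfTuple {n : ℕ} [NeZero n] {N : ℕ} (S : Fin n → Finset (Fin (2 * N)))
    (i : Fin 2 × Fin n) : ℕ :=
  (Finset.univ.filter fun t : Fin N =>
    finProdFinEquiv (i.1, t) ∈ S (i.2 + ((t : ℕ) : Fin n))).card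

lemma mem_tupleOfLengths {n : ℕ} [NeZero n] {N : ℕ} {l : Fin 2 × Fin n → ℕ} {c : Fin n}
    {a : Fin 2} {t : Fin N} : finProdFinEquiv (a, t) ∈ tupleOfLengths N l c ↔
      N ≤ (t : ℕ) + l (a, c - ((t : ℕ) : Fin n)) := by
  simp [tupleOfLengths]

/-- Positions are counted from the end of the segment, t = N-1-u. As n divides N, the segment from s
ends over s-1, which matches the indexing of `cover`. -/
lemma card_tupleOfLengths {n : ℕ} [NeZero n] {N : ℕ} (hN : n ∣ N) (l : Fin 2 × Fin n → ℕ)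
    (c : Fin n) : (tupleOfLengths N l c).card = ∑ a, cover N (fun s => l (a, s)) c := by
  rw [tupleOfLengths, Finset.card_map, Finset.card_filter, Fintype.sum_prod_type]
  refine Finset.sum_congr rfl fun a _ => ?_
  dsimp only
  rw [cover, ← Finset.sum_range_reflect, Finset.sum_range]
  refine Finset.sum_congr rfl fun t _ => ?_
  have h : c + 1 + ((N - 1 - (t : ℕ) : ℕ) : Fin n) = c - ((t : ℕ) : Fin n) := by
    rw [Nat.sub_sub, Nat.cast_sub (by omega), Fin.natCast_eq_zero.2 hN]
    push_cast
    ring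
  rw [h]
  refine if_congr ?_ rfl rfl
  omega

lemma lengthsOfTuple_tupleOfLengths {n : ℕ} [NeZero n] {N : ℕ} (l : Fin 2 × Fin n → ℕ)
    (hl : ∀ i, l i ≤ N) : lengthsOfTuple (tupleOfLengths N l) = l := by
  funext i
  simp only [lengthsOfTuple, mem_tupleOfLengths, add_sub_cancel_right]
  exact card_filter_le_add (hl i)

lemma lengthsOfTuple_le {n : ℕ} [NeZero n] {N : ℕ} (S : Fin n → Finset (Fin (2 * N)))
    (i : Fin 2 × Fin n) : lengthsOfTuple S i ≤ N :=
  (Finset.card_le_univ _).trans_eq (Fintype.card_fin N)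

lemma tupleOfLengths_lengthsOfTuple {n : ℕ} [NeZero n] {N : ℕ}
    (S : Fin n → Finset (Fin (2 * N)))
    (hS : ∀ i, ∀ j j' : Fin (2 * N), (j' : ℕ) = j + 1 → (j' : ℕ) ≠ N → j ∈ S i → j' ∈ S (i + 1)) :
    tupleOfLengths N (lengthsOfTuple S) = S := by
  funext c
  ext j
  obtain ⟨⟨a, t⟩, rfl⟩ := finProdFinEquiv.surjective j
  rw [mem_tupleOfLengths]
  have h := mem_iff_le_add_card (fun u : Fin N =>
    finProdFinEquiv (a, u) ∈ S (c - ((t : ℕ) : Fin n) + ((u : ℕ) : Fin n))) ?_ t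
  · rw [lengthsOfTuple, ← h]
    simp
  · intro u u' hu hmem
    rw [hu, Nat.cast_add, Nat.cast_one, ← add_assoc]
    refine hS _ _ _ ?_ ?_ hmem
    · simp only [finProdFinEquiv_apply_val]
      omega
    · simp only [finProdFinEquiv_apply_val]
      -- As `u' ≥ 1`, the index `u' + N * a` is never `N`: the broken arrow lies between the two
      -- components.
      fin_cases a <;> simp <;> omega

lemma tupleOfLengths_closed {n : ℕ} [NeZero n] (N : ℕ) (l : Fin 2 × Fin n → ℕ) (c : Fin n)
    (j j' : Fin (2 * N)) (hj : (j' : ℕ) = j + 1) (hN : (j' : ℕ) ≠ N)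
    (h : j ∈ tupleOfLengths N l c) : j' ∈ tupleOfLengths N l (c + 1) := by
  obtain ⟨⟨a, t⟩, rfl⟩ := finProdFinEquiv.surjective j
  obtain ⟨⟨b, u⟩, rfl⟩ := finProdFinEquiv.surjective j'
  simp only [finProdFinEquiv_apply_val] at hj hN
  -- Only `j' = N` would pass from the first component to the second, and `hN` excludes it.
  have hab : a = b ∧ (u : ℕ) = t + 1 := by
    have := t.2
    have := u.2
    fin_cases a <;> fin_cases b <;> simp at * <;> omega
  obtain ⟨rfl, hu⟩ := hab
  rw [mem_tupleOfLengths] at h ⊢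
  rw [hu]
  have : c + 1 - ((t + 1 : ℕ) : Fin n) = c - ((t : ℕ) : Fin n) := by
    push_cast
    ring
  rw [this]
  omega

/-- Closed tuples are determined by the lengths of their intersections with the segments. -/
def closedTupleEquiv (n N : ℕ) [NeZero n] (hN : n ∣ N) :
    ClosedTuple n N ≃ Lengths (Prod.snd : Fin 2 × Fin n → Fin n) N where
  toFun S := ⟨lengthsOfTuple S.1, lengthsOfTuple_le S.1,
    (sum_cover_eq_iff N _ (lengthsOfTuple_le S.1)).1 fun c => by
      rw [← card_tupleOfLengths hN, tupleOfLengths_lengthsOfTuple S.1 S.2.2, S.2.1]⟩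
  invFun l := ⟨tupleOfLengths N l.1, fun c => by
      rw [card_tupleOfLengths hN]
      exact (sum_cover_eq_iff N l.1 l.2.1).2 l.2.2 c, tupleOfLengths_closed N l.1⟩
  left_inv S := Subtype.ext (tupleOfLengths_lengthsOfTuple S.1 S.2.2)
  right_inv l := Subtype.ext (lengthsOfTuple_tupleOfLengths l.1 l.2.1)

/-! ### Configurations and segment lengths -/

/-- The column immediately to the right of the staircase in row `j`. -/
def stairCol {n : ℕ} [NeZero n] (j : Fin (2 * n)) : Fin n :=
  ⟨leftOfStair n j, by have := Nat.pos_of_neZero n; unfold leftOfStair; omega⟩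

/-- The rows, numbered by the column of the staircase and the half of the rectangle. -/
def rowEquiv (n : ℕ) : Fin 2 × Fin n ≃ Fin (2 * n) :=
  ((Equiv.refl (Fin 2)).prodCongr Fin.revPerm).trans finProdFinEquiv

lemma stairCol_rowEquiv {n : ℕ} [NeZero n] (i : Fin 2 × Fin n) :
    stairCol (rowEquiv n i) = i.2 := by
  ext
  simp [stairCol, leftOfStair, rowEquiv]
  omega

lemma steps_pos {n : ℕ} (j : Fin (2 * n)) (c : Fin n) : 0 < steps n j c := by
  unfold steps
  split_ifs <;> omega

lemma steps_le {n : ℕ} [NeZero n] (j : Fin (2 * n)) (c : Fin n) : steps n j c ≤ n := by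
  have := (stairCol j).2
  simp only [stairCol] at this
  unfold steps
  split_ifs <;> omega

lemma steps_cast {n : ℕ} [NeZero n] (j : Fin (2 * n)) (c : Fin n) :
    (steps n j c : Fin n) = stairCol j - c := by
  have hs : (leftOfStair n j : Fin n) = stairCol j := Fin.cast_val_eq_self (stairCol j)
  rw [eq_sub_iff_add_eq, ← hs]
  have : steps n j c + c = leftOfStair n j ∨ steps n j c + c = leftOfStair n j + n := by
    unfold steps
    split_ifs <;> omega
  nth_rewrite 2 [← Fin.cast_val_eq_self c]
  rw [← Nat.cast_add]
  rcases this with h | h <;> rw [h]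
  simp

/-- Residues are represented by 1, …, n, with n in place of 0, as for numbers of steps. -/
lemma eq_of_cast_eq {n p q : ℕ} [NeZero n] (hp : 0 < p) (hp' : p ≤ n) (hq : 0 < q) (hq' : q ≤ n)
    (h : (p : Fin n) = q) : p = q := by
  have := (CharP.natCast_eq_natCast (Fin n) n).1 h
  rcases hp'.lt_or_eq with h1 | rfl <;> rcases hq'.lt_or_eq with h2 | rfl
  · rwa [Nat.ModEq, Nat.mod_eq_of_lt h1, Nat.mod_eq_of_lt h2] at this
  · rw [Nat.ModEq, Nat.mod_eq_of_lt h1, Nat.mod_self] at this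
    omega
  · rw [Nat.ModEq, Nat.mod_eq_of_lt h2, Nat.mod_self] at this
    omega
  · rfl

/-- The length of the segment belonging to an entry `k` in row `j` and column `c`. -/
def rowLength (n : ℕ) (j : Fin (2 * n)) (c : Fin n) (k : ℕ) : ℕ :=
  position n j c k + n * max (k - 1) 0

lemma rowLength_zero (n : ℕ) (j : Fin (2 * n)) (c : Fin n) : rowLength n j c 0 = 0 := by
  simp [rowLength, position]

lemma rowLength_succ (n : ℕ) (j : Fin (2 * n)) (c : Fin n) (k : ℕ) :
    rowLength n j c (k + 1) = steps n j c + n * k := by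
  simp [rowLength, position]

lemma rowLength_le {n : ℕ} [NeZero n] (j : Fin (2 * n)) (c : Fin n) {k ω : ℕ} (hk : k ≤ ω) :
    rowLength n j c k ≤ ω * n := by
  rcases k with - | k
  · simp [rowLength_zero]
  · rw [rowLength_succ]
    have := Nat.mul_le_mul_right n hk
    have := steps_le j c
    linarith

/-- Full turns vanish modulo n, so only the steps count. For a zero entry the length is 0, and the
hypothesis puts the box at the separator. -/
lemma stairCol_sub_rowLength {n : ℕ} [NeZero n] (j : Fin (2 * n)) (c : Fin n) (k : ℕ)
    (hk : k = 0 → steps n j c = n) : stairCol j - (rowLength n j c k : Fin n) = c := by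
  rcases k with - | k
  · have := steps_cast j c
    rw [hk rfl, Fin.natCast_self, eq_comm, sub_eq_zero] at this
    rw [rowLength_zero, Nat.cast_zero, sub_zero, this]
  · rw [rowLength_succ, Nat.cast_add, steps_cast]
    simp

/-- The quotient is the ceiling of length over n, which is k because the steps lie in 1, …, n. -/
lemma entry_of_rowLength {n : ℕ} [NeZero n] (j : Fin (2 * n)) (c : Fin n) (k : ℕ) :
    (rowLength n j c k + (n - 1)) / n = k := by
  have hn := Nat.pos_of_neZero n
  rcases k with - | k
  · rw [rowLength_zero]
    exact Nat.div_eq_of_lt (by omega)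
  · rw [rowLength_succ]
    have h1 := steps_pos j c
    have h2 := steps_le j c
    refine (Nat.div_eq_iff hn).2 ⟨?_, ?_⟩
    · rw [Nat.succ_mul, mul_comm]; omega
    · rw [Nat.succ_mul, mul_comm]; omega

lemma rowLength_of_length {n : ℕ} [NeZero n] (j : Fin (2 * n)) (l : ℕ) :
    rowLength n j (stairCol j - (l : Fin n)) ((l + (n - 1)) / n) = l := by
  have hn := Nat.pos_of_neZero n
  rcases l with - | l
  · rw [Nat.div_eq_of_lt (by omega), rowLength_zero]
  · have h1 : l + 1 + (n - 1) = l + n := by omega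
    rw [h1, Nat.add_div_right _ hn, rowLength_succ]
    -- Dividing `l` rather than `l + 1` by `n` gives a remainder that, raised by one, lies in 1, …,
    -- n.
    have h2 : steps n j (stairCol j - ((l + 1 : ℕ) : Fin n)) = l % n + 1 := by
      refine eq_of_cast_eq (steps_pos _ _) (steps_le _ _) (Nat.succ_pos _) (Nat.mod_lt _ hn) ?_
      rw [steps_cast, sub_sub_cancel, CharP.natCast_eq_natCast (Fin n) n]
      exact ((Nat.mod_modEq l n).add_right 1).symm
    rw [h2]
    have := Nat.mod_add_div l n
    omega

/-- Configurations are determined by the lengths belonging to their rows. -/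
def configEquiv (n ω : ℕ) [NeZero n] :
    Config n ω ≃ Lengths (stairCol : Fin (2 * n) → Fin n) (ω * n) where
  toFun C := ⟨fun j => rowLength n j (C.col j) (C.entry j),
    fun j => rowLength_le _ _ (Nat.le_of_lt_succ (C.entry j).2),
    fun c => by
      simp only [stairCol_sub_rowLength _ _ _ (C.zero_box _)]
      exact C.two_per_column c,
    C.weighted_sum.trans (by ring)⟩
  invFun l :=
    { entry := fun j => ⟨(l.1 j + (n - 1)) / n, by
        have hn := Nat.pos_of_neZero n
        have := l.2.1 j
        refine Nat.div_lt_of_lt_mul ?_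
        rw [mul_add, mul_comm n ω]
        omega⟩
      col := fun j => stairCol j - (l.1 j : Fin n)
      zero_box := fun j hj => by
        have hn := Nat.pos_of_neZero n
        have h : l.1 j = 0 := by
          have := Nat.lt_of_div_eq_zero hn hj
          omega
        rw [h, Nat.cast_zero, sub_zero]
        simp [steps, stairCol]
      two_per_column := l.2.2.1
      weighted_sum := by
        refine (Finset.sum_congr rfl fun j _ => rowLength_of_length j (l.1 j)).trans
          (l.2.2.2.trans (by ring)) }
  left_inv C := by
    ext j
    · simp [entry_of_rowLength]
    · exact congrArg Fin.val (stairCol_sub_rowLength _ _ _ (C.zero_box j))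
  right_inv l := Subtype.ext (funext fun j => rowLength_of_length j (l.1 j))

end AffDellac

end

theorem theorem4p2 (n ω : ℕ) [NeZero n] :
    Nonempty (AffDellac.cells n ω ≃ AffDellac.Config n ω) :=
  ⟨(AffDellac.cellsEquiv n ω).symm.trans <| (AffDellac.fixedPointsEquiv n ω).trans <|
    (AffDellac.closedTupleEquiv n (ω * n) (Nat.dvd_mul_left n ω)).trans <|
    (AffDellac.Lengths.reindex (AffDellac.rowEquiv n) AffDellac.stairCol_rowEquiv (ω * n)).trans
    (AffDellac.configEquiv n ω).symm⟩
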